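/- Let $N\in\mathbb N$, let $\Omega\subset\mathbb R^N$ (not necessarily open), let $S$ be a real normed space of scheme parameters, and for each $s\in S$ let $F=F_s:\Omega\to\mathbb R^N$ be a bounded map. Consider the explicit scheme $y=F(x)$, $x\in\Omega$ (for instance a multi-level scheme composed into one map). Assume that $\Omega$ is * *internal path-connected*: any two points $x,x_*\in\Omega$ are joined by a continuous curve $\gamma:[0,1]\to\Omega$ of finite length $L(\gamma)$ with $\gamma([0,1])\setminus\{x,x_*\}\subseteq\operatorname{int}\Omega$; * *bounded*; * *Lipschitz*: every $x\in\partial\Omega$ is the centre of an open ball $B$ in which, in suitable Cartesian coordinates, $\partial\Omega$ is the graph of a Lipschitz function of $N-1$ variables and $\operatorname{int}\Omega$ is the part of $B$ lying on one side of this graph. Let $\Lambda_\Omega(x,x_*)=\inf L(\gamma)$ over the continuous curves $\gamma$ in $\Omega$ from $x$ to $x_*$. The scheme is *stable* if there are $s_0,C>0$ such that $$\|F(x_*)-F(x)\|\le C\,\Lambda_\Omega(x,x_*)\qquad\text{for all }x,x_*\in\Omega\text{ and all } s \text{ with }|s|\le s_0 .$$ Its *scheme in variations* is $\delta F=F'\cdot\delta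 x$, where $F'=(\partial_jF_i)_{i,j}$ is the distributional Jacobian matrix of $F$ in $\operatorname{int}\Omega$; it is *stable* if there are $s_0,C>0$ such that for all $s$ with $|s|\le s_0$ the Jacobian $F'$ is a locally integrable function and, for almost every $x\in\operatorname{int}\Omega$, $\|F'(x)\,\delta x_*-F'(x)\,\delta x\|\le C\|\delta x_*-\delta x\|$ for all $\delta x,\delta x_*\in\mathbb R^N$, that is, $\|F'(x)\|\le C$. Then the scheme is stable if and only if its scheme in variations is stable, where, as usual for Sobolev functions, $F$ is identified with its representatives. Precisely: 1. the scheme in variations of $F$ is stable if and only if there are maps $G_s:\Omega\to\mathbb R^N$ with $G_s=F_s$ almost everywhere on $\Omega$ for every $s$ such that the scheme $y=G(x)$ is stable (in particular, if the scheme $y=F(x)$ is stable, then so is its scheme in variations); 2. if every $F_s$ is continuous on $\Omega$, then the scheme $y=F(x)$ itself is stable if and only if its scheme in variations is stable. -/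

import Mathlib

open Set MeasureTheory

noncomputable section

/-- `γ`, restricted to `[0, 1]`, is a continuous curve in `Ω` from `x` to `y`. -/
def IsCurveIn {N : ℕ} (Ω : Set (EuclideanSpace ℝ (Fin N))) (x y : EuclideanSpace ℝ (Fin N))
    (γ : ℝ → EuclideanSpace ℝ (Fin N)) : Prop :=
  ContinuousOn γ (Icc 0 1) ∧ MapsTo γ (Icc 0 1) Ω ∧ γ 0 = x ∧ γ 1 = y

/-- The length of the curve `γ` on `[0, 1]`: the supremum of the lengths of inscribed polygons. -/
def curveLength {N : ℕ} (γ : ℝ → EuclideanSpace ℝ (Fin N)) : ENNReal :=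
  eVariationOn γ (Icc 0 1)

/-- `Ω` is internal path-connected: any two of its points are joined by a continuous curve in `Ω`
of finite length, all of whose points other than the end points lie in the interior of `Ω`. -/
def IsInternalPathConnected {N : ℕ} (Ω : Set (EuclideanSpace ℝ (Fin N))) : Prop :=
  ∀ x ∈ Ω, ∀ y ∈ Ω, ∃ γ : ℝ → EuclideanSpace ℝ (Fin N),
    IsCurveIn Ω x y γ ∧ curveLength γ < ⊤ ∧ (γ '' Icc 0 1) \ {x, y} ⊆ interior Ω

/-- The intrinsic metric of `Ω`: the infimum of the lengths of the continuous curves in `Ω`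
from `x` to `y`. -/
def intrinsicEDist {N : ℕ} (Ω : Set (EuclideanSpace ℝ (Fin N)))
    (x y : EuclideanSpace ℝ (Fin N)) : ENNReal :=
  ⨅ (γ : ℝ → EuclideanSpace ℝ (Fin N)) (_ : IsCurveIn Ω x y γ), curveLength γ

/-- `Ω` has a Lipschitz boundary: near each boundary point there are a unit vector `e` and a
Lipschitz function `φ` on the hyperplane orthogonal to `e`, such that the boundary of `Ω` is the
graph of `φ` over this hyperplane in the direction `e`, and the interior of `Ω` is the part that
lies on one side of this graph. -/
def HasLipschitzBoundary {N : ℕ} (Ω : Set (EuclideanSpace ℝ (Fin N))) : Prop :=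
  ∀ x ∈ frontier Ω, ∃ r > 0, ∃ e : EuclideanSpace ℝ (Fin N), ‖e‖ = 1 ∧
    ∃ (K : NNReal) (φ : (Submodule.span ℝ {e})ᗮ → ℝ), LipschitzWith K φ ∧
      frontier Ω ∩ Metric.ball x r =
        {y | inner ℝ e y = φ ((Submodule.span ℝ {e})ᗮ.orthogonalProjectionOnto y)} ∩
          Metric.ball x r ∧
      interior Ω ∩ Metric.ball x r =
        {y | φ ((Submodule.span ℝ {e})ᗮ.orthogonalProjectionOnto y) < inner ℝ e y} ∩
          Metric.ball x r

/-- On the open set `U`, the locally integrable function `g` is the distributional partial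
derivative `∂ⱼ f` of the locally integrable function `f`. -/
def HasWeakPartialDeriv {N : ℕ} (U : Set (EuclideanSpace ℝ (Fin N))) (j : Fin N)
    (f g : EuclideanSpace ℝ (Fin N) → ℝ) : Prop :=
  LocallyIntegrableOn f U volume ∧ LocallyIntegrableOn g U volume ∧
    ∀ φ : EuclideanSpace ℝ (Fin N) → ℝ, ContDiff ℝ (⊤ : ℕ∞) φ → HasCompactSupport φ →
      tsupport φ ⊆ U →
        ∫ x, f x * fderiv ℝ φ x (EuclideanSpace.single j 1) = -∫ x, g x * φ x

/-- On the open set `U`, the matrix-valued function `J = (∂ⱼ Fᵢ)ᵢⱼ` is the distributional Jacobian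
matrix of `F`. -/
def HasWeakJacobian {N : ℕ} (U : Set (EuclideanSpace ℝ (Fin N)))
    (F : EuclideanSpace ℝ (Fin N) → EuclideanSpace ℝ (Fin N))
    (J : EuclideanSpace ℝ (Fin N) → Matrix (Fin N) (Fin N) ℝ) : Prop :=
  ∀ i j, HasWeakPartialDeriv U j (fun x => F x i) (fun x => J x i j)

/-- Stability, in the intrinsic metric of `Ω`, of the scheme `y = F s x`, `x ∈ Ω`, which depends on
the vector `s` of scheme parameters. Only the values of `F s` on `Ω` matter. -/
def IsStableScheme {S : Type*} [NormedAddCommGroup S] {N : ℕ}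
    (Ω : Set (EuclideanSpace ℝ (Fin N)))
    (F : S → EuclideanSpace ℝ (Fin N) → EuclideanSpace ℝ (Fin N)) : Prop :=
  ∃ s₀ > (0 : ℝ), ∃ C > (0 : ℝ), ∀ x ∈ Ω, ∀ x' ∈ Ω, ∀ s : S, ‖s‖ ≤ s₀ →
    edist (F s x') (F s x) ≤ ENNReal.ofReal C * intrinsicEDist Ω x x'

/-- Stability of the scheme in variations `δF = F' · δx` of the scheme `y = F s x`, `x ∈ Ω`: the
distributional Jacobian `F'` exists as a function, and the linear schemes `δx ↦ F'(x) · δx` are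
stable with a constant `C` common to almost all `x` and all small `s`. That is, the operator norm
of `F'(x)` is at most `C`. -/
def IsVariationallyStable {S : Type*} [NormedAddCommGroup S] {N : ℕ}
    (Ω : Set (EuclideanSpace ℝ (Fin N)))
    (F : S → EuclideanSpace ℝ (Fin N) → EuclideanSpace ℝ (Fin N)) : Prop :=
  ∃ s₀ > (0 : ℝ), ∃ C > (0 : ℝ), ∀ s : S, ‖s‖ ≤ s₀ →
    ∃ J : EuclideanSpace ℝ (Fin N) → Matrix (Fin N) (Fin N) ℝ,
      HasWeakJacobian (interior Ω) (F s) J ∧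
        ∀ᵐ x, x ∈ interior Ω → ∀ δx δx' : EuclideanSpace ℝ (Fin N),
          ‖Matrix.toEuclideanLin (J x) δx' - Matrix.toEuclideanLin (J x) δx‖ ≤ C * ‖δx' - δx‖

end

/-!
Both directions compare `F s` with a map that is Lipschitz on the convex subsets of `interior Ω`.

If the scheme `G` is stable, then `G s` is Lipschitz with the stability constant `C` on every convex
subset of `interior Ω`, since a segment in `Ω` is a curve whose length is the distance of its end
points. By Rademacher's theorem the derivative of `G s` exists almost everywhere, its operator norm
is at most `C`, and integration by parts against Lipschitz functions of compact support shows that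
it is the weak Jacobian (`hasWeakJacobian_fderiv`).

Conversely, let the weak Jacobian be bounded by `C`. Mollifications of `F s` have derivative bounded
by `C` (`HasWeakJacobian.exists_hasFDerivAt_convolution`), so they satisfy the mean value inequality
along polygons in `interior Ω`. They converge to `F s` almost everywhere, so the inequality holds
for `F s` at almost all end points (`HasWeakJacobian.exists_ae_dist_le`). The Lipschitz boundary and
compactness of `closure Ω` give `δ` and `L`, which depend on `Ω` alone, such that points of
`interior Ω` at distance less than `δ` are joined by a polygon of length at most `L` times their
distance (`HasLipschitzBoundary.exists_joinedByPolygon`). Hence `F s` agrees almost everywhere with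
a continuous map that is `C * L`-Lipschitz at scales below `δ` on all of `Ω`
(`HasWeakJacobian.exists_continuous_ae_eq`). Cutting a curve in `Ω`, which may touch the boundary,
into pieces shorter than `δ` shows that this map expands lengths by at most `C * L`
(`edist_le_mul_intrinsicEDist`).

For continuous `F s` the continuous representative is `F s` itself, since `Ω` lies in the closure of
its interior.
-/

open scoped Convolution

/-! ### Curves and the intrinsic metric -/

theorem intrinsicEDist_le_edist {N : ℕ} {Ω : Set (EuclideanSpace ℝ (Fin N))}
    {x y : EuclideanSpace ℝ (Fin N)} (h : segment ℝ x y ⊆ Ω) :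
    intrinsicEDist Ω x y ≤ edist x y := by
  have hcurve : IsCurveIn Ω x y (AffineMap.lineMap x y : ℝ → EuclideanSpace ℝ (Fin N)) := by
    refine ⟨AffineMap.lineMap_continuous.continuousOn, fun t ht => h ?_, by simp, by simp⟩
    rw [segment_eq_image_lineMap]
    exact mem_image_of_mem _ ht
  refine (iInf₂_le _ hcurve).trans ?_
  have hlip := (lipschitzWith_lineMap (𝕜 := ℝ) x y).lipschitzOnWith (s := univ)
  have hid : eVariationOn (id : ℝ → ℝ) (Icc 0 1) = 1 := by simp
  have h := hlip.comp_eVariationOn_le (g := id) (mapsTo_univ _ (Icc (0 : ℝ) 1))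
  rwa [Function.comp_id, hid, mul_one, ← edist_nndist] at h

/-- A map that is Lipschitz at small scales expands the length of curves by at most its
Lipschitz constant, so it is Lipschitz for the intrinsic metric. -/
theorem edist_le_mul_intrinsicEDist {N : ℕ} {Ω : Set (EuclideanSpace ℝ (Fin N))}
    {G : EuclideanSpace ℝ (Fin N) → EuclideanSpace ℝ (Fin N)} {δ K : ℝ} (hδ : 0 < δ) (hK : 0 < K)
    (hG : ∀ p ∈ Ω, ∀ q ∈ Ω, dist p q < δ → dist (G p) (G q) ≤ K * dist p q)
    (x y : EuclideanSpace ℝ (Fin N)) :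
    edist (G x) (G y) ≤ ENNReal.ofReal K * intrinsicEDist Ω x y := by
  have hcurve : ∀ γ, IsCurveIn Ω x y γ →
      edist (G x) (G y) ≤ ENNReal.ofReal K * curveLength γ := by
    rintro γ ⟨hc, hm, rfl, rfl⟩
    obtain ⟨η, hη, huc⟩ := Metric.uniformContinuousOn_iff.1
      (isCompact_Icc.uniformContinuousOn_of_continuous hc) δ hδ
    obtain ⟨n, hn⟩ := exists_nat_one_div_lt hη
    let u : ℕ → ℝ := fun i => min (i / ((n : ℝ) + 1)) 1
    have hn1 : (0 : ℝ) < n + 1 := by positivity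
    have hu : Monotone u := fun i j hij => by
      dsimp only [u]
      gcongr
    have hmem : ∀ i, u i ∈ Icc (0 : ℝ) 1 := fun i =>
      ⟨le_min (by positivity) zero_le_one, min_le_right _ _⟩
    have hu0 : u 0 = 0 := by simp [u]
    have hu1 : u (n + 1) = 1 := by
      simp [u, div_self hn1.ne']
    have hstep : ∀ i, dist (u i) (u (i + 1)) < η := fun i => by
      have h1 : dist (u i) (u (i + 1)) ≤ 1 / ((n : ℝ) + 1) := by
        rw [dist_comm, Real.dist_eq, abs_of_nonneg (sub_nonneg.2 (hu (Nat.le_succ i))),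
          sub_le_iff_le_add]
        dsimp only [u]
        rw [← min_add_add_left]
        refine min_le_min ?_ (by simp; positivity)
        push_cast
        rw [add_div, add_comm]
      exact h1.trans_lt hn
    calc edist (G (γ 0)) (G (γ 1))
        = edist (G (γ (u 0))) (G (γ (u (n + 1)))) := by rw [hu0, hu1]
      _ ≤ ∑ i ∈ Finset.range (n + 1), edist (G (γ (u i))) (G (γ (u (i + 1)))) :=
          edist_le_range_sum_edist (fun i => G (γ (u i))) (n + 1)
      _ ≤ ∑ i ∈ Finset.range (n + 1),
            ENNReal.ofReal K * edist (γ (u (i + 1))) (γ (u i)) := by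
          refine Finset.sum_le_sum fun i _ => ?_
          have := hG _ (hm (hmem i)) _ (hm (hmem (i + 1)))
            (huc _ (hmem i) _ (hmem (i + 1)) (hstep i))
          rw [edist_comm (γ (u (i + 1))), edist_dist, edist_dist, ← ENNReal.ofReal_mul hK.le]
          exact ENNReal.ofReal_le_ofReal this
      _ = ENNReal.ofReal K *
            ∑ i ∈ Finset.range (n + 1), edist (γ (u (i + 1))) (γ (u i)) := by
          rw [Finset.mul_sum]
      _ ≤ ENNReal.ofReal K * curveLength γ := by
          gcongr
          exact eVariationOn.sum_le hu hmem
  have hK0 : ENNReal.ofReal K ≠ 0 := by simpa using hK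
  unfold intrinsicEDist
  rw [ENNReal.mul_iInf_of_ne hK0 ENNReal.ofReal_ne_top]
  refine le_iInf fun γ => ?_
  rw [ENNReal.mul_iInf_of_ne hK0 ENNReal.ofReal_ne_top]
  exact le_iInf fun hγ => hcurve γ hγ

/-! ### Geometry of Lipschitz domains -/

theorem orthogonalProjectionOnto_add_smul {E : Type*} [NormedAddCommGroup E]
    [InnerProductSpace ℝ E] (e y : E) (t : ℝ) :
    (Submodule.span ℝ {e})ᗮ.orthogonalProjectionOnto (y + t • e) =
      (Submodule.span ℝ {e})ᗮ.orthogonalProjectionOnto y := by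
  have he : (Submodule.span ℝ {e})ᗮ.orthogonalProjectionOnto e = 0 := by
    rw [Submodule.orthogonalProjectionOnto_eq_zero_iff]
    exact Submodule.le_orthogonal_orthogonal _ (Submodule.mem_span_singleton_self e)
  simp [he]

theorem inner_add_smul_of_norm_eq_one {E : Type*} [NormedAddCommGroup E] [InnerProductSpace ℝ E]
    {e : E} (he : ‖e‖ = 1) (y : E) (t : ℝ) : inner ℝ e (y + t • e) = inner ℝ e y + t := by
  simp [inner_add_right, real_inner_smul_right, he]

/-- A graph is a null set, because infinitely many of its translates, by vectors from a bounded
set, are disjoint. -/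
theorem volume_graph_eq_zero {N : ℕ} {e : EuclideanSpace ℝ (Fin N)} (he : ‖e‖ = 1)
    {φ : (Submodule.span ℝ {e})ᗮ → ℝ} (hφ : Continuous φ) :
    volume {y | inner ℝ e y = φ ((Submodule.span ℝ {e})ᗮ.orthogonalProjectionOnto y)} = 0 := by
  refine Measure.addHaar_eq_zero_of_disjoint_translates volume
    (u := fun n : ℕ => (1 / ((n : ℝ) + 1)) • e) ?_ ?_ ?_
  · refine (Metric.isBounded_closedBall (x := (0 : EuclideanSpace ℝ (Fin N))) (r := 1)).subset ?_
    rintro _ ⟨n, rfl⟩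
    have : (1 : ℝ) / (n + 1) ≤ 1 := by
      rw [div_le_one (by positivity)]
      simp
    rw [mem_closedBall_zero_iff, norm_smul, he, mul_one, Real.norm_of_nonneg (by positivity)]
    exact this
  · intro m n hmn
    rw [Function.onFun, Set.disjoint_left]
    rintro z hz hz'
    rw [singleton_add, mem_image] at hz hz'
    obtain ⟨a, ha, rfl⟩ := hz
    obtain ⟨b, hb, hab⟩ := hz'
    apply hmn
    have hinner := congrArg (fun y => (inner ℝ e y : ℝ)) hab
    have hproj := congrArg (fun y => (Submodule.span ℝ {e})ᗮ.orthogonalProjectionOnto y) hab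
    simp only [add_comm _ a, add_comm _ b, orthogonalProjectionOnto_add_smul,
      inner_add_smul_of_norm_eq_one he] at hinner hproj
    rw [mem_ofPred_eq] at ha hb
    rw [ha, hb, hproj] at hinner
    have h : (n : ℝ) + 1 = m + 1 := by
      simpa using add_left_cancel hinner
    exact_mod_cast (add_right_cancel h).symm
  · exact (isClosed_eq (by fun_prop) (by fun_prop)).measurableSet

theorem HasLipschitzBoundary.volume_frontier {N : ℕ} {Ω : Set (EuclideanSpace ℝ (Fin N))}
    (h : HasLipschitzBoundary Ω) : volume (frontier Ω) = 0 := by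
  refine measure_null_of_locally_null _ fun x hx => ?_
  obtain ⟨r, hr, e, he, K, φ, hφ, hfr, -⟩ := h x hx
  refine ⟨frontier Ω ∩ Metric.ball x r,
    Filter.inter_mem self_mem_nhdsWithin (mem_nhdsWithin_of_mem_nhds (Metric.ball_mem_nhds x hr)),
    ?_⟩
  rw [hfr]
  exact measure_mono_null inter_subset_left (volume_graph_eq_zero he hφ.continuous)

theorem HasLipschitzBoundary.closure_subset_closure_interior {N : ℕ}
    {Ω : Set (EuclideanSpace ℝ (Fin N))} (h : HasLipschitzBoundary Ω) :
    closure Ω ⊆ closure (interior Ω) := by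
  intro x hx
  by_cases hxi : x ∈ interior Ω
  · exact subset_closure hxi
  have hxf : x ∈ frontier Ω := ⟨hx, hxi⟩
  obtain ⟨r, hr, e, he, K, φ, hφ, hfr, hint⟩ := h x hxf
  have hx0 : inner ℝ e x = φ ((Submodule.span ℝ {e})ᗮ.orthogonalProjectionOnto x) :=
    (hfr.subset ⟨hxf, Metric.mem_ball_self hr⟩).1
  rw [Metric.mem_closure_iff]
  intro ε hε
  let t := min (ε / 2) (r / 2)
  have ht : 0 < t := lt_min (half_pos hε) (half_pos hr)
  have hd : dist x (x + t • e) = t := by simp [norm_smul, he, abs_of_pos ht]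
  refine ⟨x + t • e, (hint.superset ⟨?_, ?_⟩).1, ?_⟩
  · rw [mem_ofPred_eq, orthogonalProjectionOnto_add_smul, inner_add_smul_of_norm_eq_one he, ← hx0]
    linarith
  · rw [Metric.mem_ball, dist_comm, hd]
    exact (min_le_right _ _).trans_lt (half_lt_self hr)
  · rw [hd]
    exact (min_le_left _ _).trans_lt (half_lt_self hε)

theorem HasLipschitzBoundary.ae_mem_interior {N : ℕ} {Ω : Set (EuclideanSpace ℝ (Fin N))}
    (h : HasLipschitzBoundary Ω) : ∀ᵐ x, x ∈ Ω → x ∈ interior Ω := by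
  filter_upwards [measure_eq_zero_iff_ae_notMem.1 h.volume_frontier] with x hx hxΩ
  by_contra hxi
  exact hx ⟨subset_closure hxΩ, hxi⟩

/-- The points `p` and `q` are joined by a polygon of three segments in `U`, of length at most
`L * dist p q`. -/
def JoinedByPolygon {E : Type*} [NormedAddCommGroup E] [NormedSpace ℝ E] (U : Set E) (L : ℝ)
    (p q : E) : Prop :=
  ∃ a b, segment ℝ p a ⊆ U ∧ segment ℝ a b ⊆ U ∧ segment ℝ b q ⊆ U ∧
    dist p a + dist a b + dist b q ≤ L * dist p q

theorem JoinedByPolygon.mono {E : Type*} [NormedAddCommGroup E] [NormedSpace ℝ E] {U : Set E}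
    {L L' : ℝ} {p q : E} (h : JoinedByPolygon U L p q) (hL : L ≤ L') :
    JoinedByPolygon U L' p q := by
  obtain ⟨a, b, h1, h2, h3, h4⟩ := h
  exact ⟨a, b, h1, h2, h3, h4.trans (by gcongr)⟩

theorem joinedByPolygon_of_segment_subset {E : Type*} [NormedAddCommGroup E] [NormedSpace ℝ E]
    {U : Set E} {p q : E} (h : segment ℝ p q ⊆ U) : JoinedByPolygon U 1 p q :=
  ⟨p, p, by simpa using h (left_mem_segment ℝ p q), by simpa using h (left_mem_segment ℝ p q), h,
    by simp⟩

/-- Above the graph of a `K`-Lipschitz function, two points at distance `d` are joined by lifting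
both of them by `(K + 1) * d`. The segment between the lifted points stays above the graph. -/
theorem joinedByPolygon_of_lipschitz_graph {N : ℕ} {U : Set (EuclideanSpace ℝ (Fin N))}
    {x e : EuclideanSpace ℝ (Fin N)} {r : ℝ} (he : ‖e‖ = 1) {K : NNReal}
    {φ : (Submodule.span ℝ {e})ᗮ → ℝ} (hφ : LipschitzWith K φ)
    (hU : U ∩ Metric.ball x r =
      {y | φ ((Submodule.span ℝ {e})ᗮ.orthogonalProjectionOnto y) < inner ℝ e y} ∩
        Metric.ball x r)
    {p q : EuclideanSpace ℝ (Fin N)} (hp : p ∈ U) (hq : q ∈ U)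
    (hpx : dist p x < r / (2 * K + 3)) (hqx : dist q x < r / (2 * K + 3)) :
    JoinedByPolygon U (2 * K + 3) p q := by
  set P := (Submodule.span ℝ {e})ᗮ.orthogonalProjectionOnto
  have hK : (0 : ℝ) < 2 * K + 3 := by positivity
  set ρ := r / (2 * (K : ℝ) + 3) with hρ
  have hr : r = (2 * K + 3) * ρ := by rw [hρ]; field_simp
  have hρ0 : 0 < ρ := dist_nonneg.trans_lt hpx
  have hρr : ρ ≤ r := by
    rw [hr]
    nlinarith [K.coe_nonneg]
  set d := dist p q with hd
  have hd0 : 0 ≤ d := dist_nonneg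
  have hdρ : d < 2 * ρ := by
    have := dist_triangle_right p q x
    linarith
  set t := (K + 1) * d with ht
  have ht0 : 0 ≤ t := by positivity
  have htr : ρ + t ≤ r := by
    rw [ht, hr]
    nlinarith [K.coe_nonneg]
  have hp' : φ (P p) < inner ℝ e p :=
    (hU.subset ⟨hp, Metric.mem_ball.2 (hpx.trans_le hρr)⟩).1
  have hq' : φ (P q) < inner ℝ e q :=
    (hU.subset ⟨hq, Metric.mem_ball.2 (hqx.trans_le hρr)⟩).1
  -- A point near `x` that is lifted by at most `t` remains in the ball.
  have hball : ∀ y s, dist y x < ρ → 0 ≤ s → s ≤ t → y + s • e ∈ Metric.ball x r := by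
    intro y s hy hs hst
    have h1 : dist (y + s • e) y = s := by simp [dist_eq_norm, norm_smul, he, abs_of_nonneg hs]
    rw [Metric.mem_ball]
    linarith [dist_triangle (y + s • e) y x]
  have hlift : ∀ y, dist y x < ρ → φ (P y) < inner ℝ e y → segment ℝ y (y + t • e) ⊆ U := by
    intro y hy hy'
    rw [segment_eq_image']
    rintro _ ⟨θ, hθ, rfl⟩
    have hz : y + θ • (y + t • e - y) = y + (θ * t) • e := by
      rw [add_sub_cancel_left, smul_smul]
    change y + θ • (y + t • e - y) ∈ U
    rw [hz]
    have h0 : 0 ≤ θ * t := mul_nonneg hθ.1 ht0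
    refine (hU.superset ⟨?_, hball y _ hy h0 (mul_le_of_le_one_left ht0 hθ.2)⟩).1
    rw [mem_ofPred_eq, orthogonalProjectionOnto_add_smul, inner_add_smul_of_norm_eq_one he]
    linarith
  have hde : ∀ y : EuclideanSpace ℝ (Fin N), dist y (y + t • e) = t := fun y => by
    simp [norm_smul, he, abs_of_nonneg ht0]
  refine ⟨p + t • e, q + t • e, hlift p hpx hp', ?_, ?_, ?_⟩
  · rw [segment_eq_image']
    rintro _ ⟨θ, hθ, rfl⟩
    have hz : p + t • e + θ • (q + t • e - (p + t • e)) = (p + θ • (q - p)) + t • e := by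
      rw [add_sub_add_right_eq_sub]
      abel
    change p + t • e + θ • (q + t • e - (p + t • e)) ∈ U
    rw [hz]
    set y := p + θ • (q - p) with hy
    have hyp : dist y p ≤ d := by
      rw [hy, dist_eq_norm, add_sub_cancel_left, norm_smul, Real.norm_of_nonneg hθ.1, hd,
        dist_comm, dist_eq_norm]
      exact mul_le_of_le_one_left (norm_nonneg _) hθ.2
    have hyx : dist y x < ρ := by
      have hmem : y ∈ segment ℝ p q := by
        rw [segment_eq_image']
        exact ⟨θ, hθ, rfl⟩
      exact (convex_ball x ρ).segment_subset (Metric.mem_ball.2 hpx) (Metric.mem_ball.2 hqx) hmem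
    refine (hU.superset ⟨?_, hball y _ hyx ht0 le_rfl⟩).1
    rw [mem_ofPred_eq, orthogonalProjectionOnto_add_smul, inner_add_smul_of_norm_eq_one he]
    have h1 : φ (P y) - φ (P p) ≤ K * d := by
      have h2 : dist (φ (P y)) (φ (P p)) ≤ K * dist (P y) (P p) := hφ.dist_le_mul _ _
      have h3 : dist (P y) (P p) ≤ dist y p := by
        simpa using (Submodule.lipschitzWith_orthogonalProjectionOnto
          (Submodule.span ℝ {e})ᗮ).dist_le_mul y p
      calc φ (P y) - φ (P p) ≤ dist (φ (P y)) (φ (P p)) := le_abs_self _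
        _ ≤ K * dist (P y) (P p) := h2
        _ ≤ K * d := by gcongr; exact h3.trans hyp
    have h4 : inner ℝ e p - inner ℝ e y ≤ d := by
      rw [← inner_sub_right]
      calc inner ℝ e (p - y) ≤ ‖e‖ * ‖p - y‖ := real_inner_le_norm _ _
        _ = dist y p := by rw [he, one_mul, dist_comm, dist_eq_norm]
        _ ≤ d := hyp
    have h5 : t = K * d + d := by rw [ht]; ring
    linarith
  · rw [segment_symm]
    exact hlift q hqx hq'
  · rw [hde, dist_comm _ q, hde, dist_add_right, ← hd, ht]
    apply le_of_eq
    ring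

/-- In a bounded Lipschitz domain the intrinsic distance of points that are close to each other
is at most a constant times their distance. -/
theorem HasLipschitzBoundary.exists_joinedByPolygon {N : ℕ} {Ω : Set (EuclideanSpace ℝ (Fin N))}
    (h : HasLipschitzBoundary Ω) (hb : Bornology.IsBounded Ω) :
    ∃ δ > (0 : ℝ), ∃ L ≥ (1 : ℝ), ∀ p ∈ interior Ω, ∀ q ∈ interior Ω, dist p q < δ →
      JoinedByPolygon (interior Ω) L p q := by
  have hcomp : IsCompact (closure Ω) := hb.isCompact_closure
  suffices hs : ∃ δ > (0 : ℝ), ∃ L ≥ (1 : ℝ), ∀ p ∈ interior Ω, p ∈ closure Ω →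
      ∀ q ∈ interior Ω, dist p q < δ → JoinedByPolygon (interior Ω) L p q by
    obtain ⟨δ, hδ, L, hL, H⟩ := hs
    exact ⟨δ, hδ, L, hL, fun p hp => H p hp (subset_closure (interior_subset hp))⟩
  refine hcomp.induction_on (p := fun s => ∃ δ > (0 : ℝ), ∃ L ≥ (1 : ℝ), ∀ p ∈ interior Ω, p ∈ s →
      ∀ q ∈ interior Ω, dist p q < δ → JoinedByPolygon (interior Ω) L p q) ?_ ?_ ?_ ?_
  · exact ⟨1, one_pos, 1, le_rfl, by simp⟩
  · rintro s t hst ⟨δ, hδ, L, hL, H⟩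
    exact ⟨δ, hδ, L, hL, fun p hp hps => H p hp (hst hps)⟩
  · rintro s t ⟨δ, hδ, L, hL, H⟩ ⟨δ', hδ', L', hL', H'⟩
    refine ⟨min δ δ', lt_min hδ hδ', max L L', le_max_of_le_left hL, ?_⟩
    rintro p hp (hps | hpt) q hq hpq
    · exact (H p hp hps q hq (hpq.trans_le (min_le_left _ _))).mono (le_max_left _ _)
    · exact (H' p hp hpt q hq (hpq.trans_le (min_le_right _ _))).mono (le_max_right _ _)
  · intro x hx
    by_cases hxi : x ∈ interior Ω
    · obtain ⟨r, hr, hball⟩ := Metric.isOpen_iff.1 isOpen_interior x hxi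
      refine ⟨Metric.ball x (r / 2),
        mem_nhdsWithin_of_mem_nhds (Metric.ball_mem_nhds x (half_pos hr)),
        r / 2, half_pos hr, 1, le_rfl, fun p _ hpx q _ hpq => ?_⟩
      refine joinedByPolygon_of_segment_subset (Subset.trans ?_ hball)
      rw [Metric.mem_ball] at hpx
      refine (convex_ball x r).segment_subset ?_ ?_ <;> rw [Metric.mem_ball]
      · linarith
      · linarith [dist_triangle_left q x p]
    · obtain ⟨r, hr, e, he, K, φ, hφ, -, hint⟩ := h x ⟨hx, hxi⟩
      have hρ : 0 < r / (2 * (K : ℝ) + 3) := by positivity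
      refine ⟨Metric.ball x (r / (2 * (K : ℝ) + 3) / 2),
        mem_nhdsWithin_of_mem_nhds (Metric.ball_mem_nhds x (half_pos hρ)),
        r / (2 * (K : ℝ) + 3) / 2, half_pos hρ, 2 * K + 3, by linarith [K.coe_nonneg],
        fun p hp hpx q hq hpq => ?_⟩
      rw [Metric.mem_ball] at hpx
      refine joinedByPolygon_of_lipschitz_graph he hφ hint hp hq ?_ ?_
      · linarith
      · linarith [dist_triangle_left q x p]

/-! ### Stable schemes have bounded weak Jacobians -/

theorem lipschitzOnWith_of_edist_le_intrinsicEDist {N : ℕ} {Ω s : Set (EuclideanSpace ℝ (Fin N))}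
    {G : EuclideanSpace ℝ (Fin N) → EuclideanSpace ℝ (Fin N)} {C : ℝ}
    (hG : ∀ x ∈ Ω, ∀ x' ∈ Ω, edist (G x') (G x) ≤ ENNReal.ofReal C * intrinsicEDist Ω x x')
    (hs : Convex ℝ s) (hsΩ : s ⊆ Ω) : LipschitzOnWith C.toNNReal G s := by
  intro x hx y hy
  refine (hG y (hsΩ hy) x (hsΩ hx)).trans ?_
  rw [edist_comm x y]
  exact mul_le_mul_right (intrinsicEDist_le_edist ((hs.segment_subset hy hx).trans hsΩ)) _

theorem toEuclideanLin_of_apply_single {N : ℕ}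
    (T : EuclideanSpace ℝ (Fin N) →L[ℝ] EuclideanSpace ℝ (Fin N))
    (v : EuclideanSpace ℝ (Fin N)) :
    Matrix.toEuclideanLin (Matrix.of fun i j => T (EuclideanSpace.single j 1) i) v = T v := by
  ext i
  conv_rhs => rw [← (EuclideanSpace.basisFun (Fin N) ℝ).sum_repr v]
  simp [Matrix.mulVec, dotProduct, mul_comm]

theorem locallyIntegrableOn_of_ae_eq {N : ℕ} {U : Set (EuclideanSpace ℝ (Fin N))}
    (hU : IsOpen U) {f g : EuclideanSpace ℝ (Fin N) → ℝ} (hf : LocallyIntegrableOn f U volume)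
    (hfg : ∀ᵐ x, x ∈ U → f x = g x) : LocallyIntegrableOn g U volume := by
  intro x hx
  obtain ⟨s, hs, hi⟩ := hf x hx
  refine ⟨s ∩ U, Filter.inter_mem hs self_mem_nhdsWithin,
    (hi.mono_set inter_subset_left).congr_fun_ae ?_⟩
  exact ae_restrict_of_ae_restrict_of_subset inter_subset_right
    ((ae_restrict_iff' hU.measurableSet).2 hfg)

/-- A map with a common Lipschitz constant on the convex subsets of an open set `U` has a weak
Jacobian in `U`, namely its pointwise derivative, which exists almost everywhere by Rademacher's
theorem. -/
theorem hasWeakJacobian_fderiv {N : ℕ} {U : Set (EuclideanSpace ℝ (Fin N))} (hU : IsOpen U)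
    {F G : EuclideanSpace ℝ (Fin N) → EuclideanSpace ℝ (Fin N)} {C : NNReal}
    (hG : ∀ s ⊆ U, Convex ℝ s → LipschitzOnWith C G s) (hGF : ∀ᵐ x, x ∈ U → G x = F x) :
    HasWeakJacobian U F
      (fun x => Matrix.of fun i j => fderiv ℝ G x (EuclideanSpace.single j 1) i) := by
  have hloc : LocallyLipschitzOn U G := fun x hx => by
    obtain ⟨r, hr, hball⟩ := Metric.isOpen_iff.1 hU x hx
    exact ⟨C, Metric.ball x r, mem_nhdsWithin_of_mem_nhds (Metric.ball_mem_nhds x hr),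
      hG _ hball (convex_ball x r)⟩
  intro i j
  refine ⟨?_, ?_, fun φ hφ hφc hφU => ?_⟩
  · have hGi : LocallyIntegrableOn (fun x => G x i) U volume :=
      ContinuousOn.locallyIntegrableOn
        ((EuclideanSpace.proj (𝕜 := ℝ) i).continuous.comp_continuousOn hloc.continuousOn)
        hU.measurableSet
    refine locallyIntegrableOn_of_ae_eq hU hGi ?_
    filter_upwards [hGF] with x hx hxU
    rw [hx hxU]
  · intro x hx
    obtain ⟨r, hr, hball⟩ := Metric.isOpen_iff.1 hU x hx
    refine ⟨Metric.ball x r, mem_nhdsWithin_of_mem_nhds (Metric.ball_mem_nhds x hr), ?_⟩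
    refine Measure.integrableOn_of_bounded (M := C) measure_ball_lt_top.ne ?_ ?_
    · have hm : Measurable fun x => EuclideanSpace.proj (𝕜 := ℝ) i
          (fderiv ℝ G x (EuclideanSpace.single j 1)) :=
        (EuclideanSpace.proj (𝕜 := ℝ) i).continuous.measurable.comp
          (measurable_fderiv_apply_const ℝ G _)
      exact hm.aestronglyMeasurable
    · refine (ae_restrict_iff' measurableSet_ball).2 (.of_forall fun y hy => ?_)
      have h1 : ‖fderiv ℝ G y‖ ≤ C :=
        norm_fderiv_le_of_lipschitzOn ℝ (Metric.isOpen_ball.mem_nhds hy)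
          (hG _ hball (convex_ball x r))
      calc ‖fderiv ℝ G y (EuclideanSpace.single j 1) i‖
          ≤ ‖fderiv ℝ G y (EuclideanSpace.single j 1)‖ := PiLp.norm_apply_le _ i
        _ ≤ ‖fderiv ℝ G y‖ * ‖EuclideanSpace.single j (1 : ℝ)‖ := ContinuousLinearMap.le_opNorm _ _
        _ ≤ C := by simpa using h1
  -- Near the support of `φ`, the map `G` coincides with a globally Lipschitz map `g`.
  · obtain ⟨δ, hδ, hδU⟩ := hφc.isCompact.exists_cthickening_subset_open hU hφU
    obtain ⟨D, hD⟩ := (hloc.mono hδU).exists_lipschitzOnWith_of_compact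
      hφc.isCompact.cthickening
    obtain ⟨g, hg, hgG⟩ := hD.extend_finite_dimension
    have hnhds : ∀ x ∈ tsupport φ, Metric.cthickening δ (tsupport φ) ∈ nhds x := fun x hx =>
      Filter.mem_of_superset (Metric.isOpen_thickening.mem_nhds
        (Metric.self_subset_thickening hδ _ hx)) (Metric.thickening_subset_cthickening _ _)
    have hgi : LipschitzWith _ (fun x => g x i) := (LipschitzWith.of_dist_le_mul (K := 1)
      (fun x y => by
        simpa [dist_eq_norm] using PiLp.norm_apply_le (x - y) i) :
        LipschitzWith 1 (fun x : EuclideanSpace ℝ (Fin N) => x i)).comp hg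
    obtain ⟨D', hφL⟩ := hφ.lipschitzWith_of_hasCompactSupport hφc (by simp)
    have hparts := hgi.integral_lineDeriv_mul_eq (μ := volume) hφL hφc (EuclideanSpace.single j 1)
    have hleft : ∫ x, F x i * fderiv ℝ φ x (EuclideanSpace.single j 1) =
        -∫ x, lineDeriv ℝ φ x (-EuclideanSpace.single j 1) * g x i := by
      rw [← integral_neg]
      refine integral_congr_ae ?_
      filter_upwards [hGF] with x hx
      rw [(hφ.differentiable (by simp)).differentiableAt.lineDeriv_eq_fderiv]
      by_cases hxs : x ∈ tsupport φ
      · rw [← hx (hφU hxs), hgG (mem_of_mem_nhds (hnhds x hxs)), map_neg]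
        ring
      · simp [fderiv_of_notMem_tsupport ℝ hxs]
    rw [hleft, ← hparts, neg_inj]
    refine integral_congr_ae ?_
    filter_upwards [hg.ae_differentiableAt (μ := volume)] with x hx
    by_cases hxs : x ∈ tsupport φ
    · have heq : G =ᶠ[nhds x] g := Filter.eventuallyEq_of_mem (hnhds x hxs) hgG
      have hder : HasFDerivAt (fun x => g x i)
          ((EuclideanSpace.proj (𝕜 := ℝ) i).comp (fderiv ℝ g x)) x :=
        (EuclideanSpace.proj (𝕜 := ℝ) i).hasFDerivAt.comp x hx.hasFDerivAt
      rw [(hder.hasLineDerivAt _).lineDeriv]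
      simp [heq.fderiv_eq]
    · simp [image_eq_zero_of_notMem_tsupport hxs]

theorem IsStableScheme.isVariationallyStable {S : Type*} [NormedAddCommGroup S] {N : ℕ}
    {Ω : Set (EuclideanSpace ℝ (Fin N))}
    {F G : S → EuclideanSpace ℝ (Fin N) → EuclideanSpace ℝ (Fin N)} (hG : IsStableScheme Ω G)
    (hGF : ∀ s, ∀ᵐ x, x ∈ Ω → G s x = F s x) : IsVariationallyStable Ω F := by
  obtain ⟨s₀, hs₀, C, hC, H⟩ := hG
  refine ⟨s₀, hs₀, C, hC, fun s hs => ?_⟩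
  have hlip : ∀ t ⊆ interior Ω, Convex ℝ t → LipschitzOnWith C.toNNReal (G s) t :=
    fun t ht htc => lipschitzOnWith_of_edist_le_intrinsicEDist
      (fun x hx x' hx' => H x hx x' hx' s hs) htc (ht.trans interior_subset)
  refine ⟨_, hasWeakJacobian_fderiv isOpen_interior hlip ?_, .of_forall fun x hx v v' => ?_⟩
  · filter_upwards [hGF s] with x hx hxi using hx (interior_subset hxi)
  · obtain ⟨r, hr, hball⟩ := Metric.isOpen_iff.1 isOpen_interior x hx
    have h1 : ‖fderiv ℝ (G s) x‖ ≤ C := by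
      simpa [hC.le] using norm_fderiv_le_of_lipschitzOn ℝ (Metric.ball_mem_nhds x hr)
        (hlip _ hball (convex_ball x r))
    rw [toEuclideanLin_of_apply_single, toEuclideanLin_of_apply_single, ← map_sub]
    exact (fderiv ℝ (G s) x).le_of_opNorm_le h1 _

/-! ### Mollification of maps with a bounded weak Jacobian -/

/-- The mollification of `F` is differentiable, and its derivative is the mollification of the
weak Jacobian of `F`. Hence a bound on the weak Jacobian passes to this derivative. -/
theorem HasWeakJacobian.exists_hasFDerivAt_convolution {N : ℕ}
    {U : Set (EuclideanSpace ℝ (Fin N))} {F : EuclideanSpace ℝ (Fin N) → EuclideanSpace ℝ (Fin N)}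
    {J : EuclideanSpace ℝ (Fin N) → Matrix (Fin N) (Fin N) ℝ} (hJ : HasWeakJacobian U F J)
    (hF : LocallyIntegrable (U.indicator F) volume) {C : ℝ} (hC : 0 ≤ C)
    (hJC : ∀ᵐ x, x ∈ U → ∀ v, ‖Matrix.toEuclideanLin (J x) v‖ ≤ C * ‖v‖)
    (ψ : ContDiffBump (0 : EuclideanSpace ℝ (Fin N))) {x : EuclideanSpace ℝ (Fin N)}
    (hx : Metric.closedBall x ψ.rOut ⊆ U) :
    ∃ T : EuclideanSpace ℝ (Fin N) →L[ℝ] EuclideanSpace ℝ (Fin N),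
      HasFDerivAt (ψ.normed volume ⋆[ContinuousLinearMap.lsmul ℝ ℝ, volume] U.indicator F) T x ∧
        ‖T‖ ≤ C := by
  set ρ := ψ.normed volume with hρ
  have hρs : ContDiff ℝ (⊤ : ℕ∞) ρ := ψ.contDiff_normed
  have hρc : HasCompactSupport ρ := ψ.hasCompactSupport_normed
  refine ⟨_, hρc.hasFDerivAt_convolution_left _ (hρs.of_le (by simp)) hF x, ?_⟩
  set T := (fderiv ℝ ρ ⋆[(ContinuousLinearMap.lsmul ℝ ℝ).precompL _, volume] U.indicator F) x
    with hT
  -- The test function that evaluates mollifications at `x`.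
  set φ : EuclideanSpace ℝ (Fin N) → ℝ := fun y => ρ (x - y) with hφ
  have hφs : ContDiff ℝ (⊤ : ℕ∞) φ := hρs.comp (contDiff_const.sub contDiff_id)
  have hφsupp : ∀ y, y ∉ Metric.closedBall x ψ.rOut → φ y = 0 := by
    intro y hy
    have h : x - y ∉ Function.support ρ := by
      rw [hρ, ψ.support_normed_eq, mem_ball_zero_iff, ← dist_eq_norm, dist_comm, not_lt]
      exact (not_le.1 hy).le
    simpa using h
  have hφt : tsupport φ ⊆ Metric.closedBall x ψ.rOut :=
    closure_minimal (fun y hy => by_contra fun h => hy (hφsupp y h)) Metric.isClosed_closedBall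
  have hφc : HasCompactSupport φ :=
    HasCompactSupport.intro (isCompact_closedBall x ψ.rOut) hφsupp
  have hφ0 : ∀ y, 0 ≤ φ y := fun y => ψ.nonneg_normed _
  have hφi : Integrable φ := hφs.continuous.integrable_of_hasCompactSupport hφc
  have hφ1 : ∫ y, φ y = 1 := by
    rw [hφ, integral_sub_left_eq_self ρ volume x, hρ, ψ.integral_normed]
  have hφU : tsupport φ ⊆ U := hφt.trans hx
  have hφd : ∀ y v, fderiv ℝ φ y v = -fderiv ℝ ρ (x - y) v := by
    intro y v
    have h1 : HasFDerivAt ρ (fderiv ℝ ρ (x - y)) (x - y) :=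
      ((hρs.differentiable (by simp)) _).hasFDerivAt
    have h2 := h1.comp y ((hasFDerivAt_const x y).sub (hasFDerivAt_id y))
    change fderiv ℝ (ρ ∘ fun y => x - y) y v = _
    rw [HasFDerivAt.fderiv h2]
    simp
  have hTint : Integrable (fun y => (ContinuousLinearMap.lsmul ℝ ℝ).precompL
      (EuclideanSpace ℝ (Fin N)) (fderiv ℝ ρ (x - y)) (U.indicator F y)) :=
    ((hρc.fderiv (𝕜 := ℝ)).convolutionExists_left _ (hρs.continuous_fderiv (by simp)) hF
      x).integrable_swap
  have hTv : ∀ v, T v = ∫ y, fderiv ℝ ρ (x - y) v • U.indicator F y := by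
    intro v
    rw [hT, convolution_eq_swap, ContinuousLinearMap.integral_apply hTint]
    rfl
  have hTvint : ∀ v, Integrable fun y => fderiv ℝ ρ (x - y) v • U.indicator F y :=
    fun v => hTint.apply_continuousLinearMap v
  have hJint : ∀ i j, Integrable fun y => φ y * J y i j := by
    intro i j
    have h1 : IntegrableOn (fun y => φ y * J y i j) (tsupport φ) :=
      ((hJ i j).2.1.integrableOn_compact_subset hφU hφc).continuousOn_mul
        hφs.continuous.continuousOn hφc
    refine (integrableOn_iff_integrable_of_support_subset fun y hy => ?_).1 h1
    exact subset_tsupport _ (left_ne_zero_of_mul hy)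
  have hTe : ∀ i j, T (EuclideanSpace.single j 1) i = ∫ y, φ y * J y i j := by
    intro i j
    have h1 := (hJ i j).2.2 φ hφs hφc hφU
    rw [hTv, eval_integral_piLp fun i => (hTvint _).eval_piLp i]
    simp_rw [mul_comm (φ _)]
    rw [← neg_eq_iff_eq_neg.2 h1, ← integral_neg]
    refine integral_congr_ae (.of_forall fun y => ?_)
    by_cases hy : y ∈ U
    · simp [hφd, hy, mul_comm]
    · have h0 : fderiv ℝ φ y = 0 := fderiv_of_notMem_tsupport ℝ fun h => hy (hφU h)
      simp [hy, h0]
  have hJv : ∀ v i, Integrable fun y => (φ y • Matrix.toEuclideanLin (J y) v) i := by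
    intro v i
    have h1 : Integrable fun y => ∑ j, φ y * J y i j * v j :=
      integrable_finsetSum _ fun j _ => (hJint i j).mul_const _
    refine h1.congr (.of_forall fun y => ?_)
    simp [Matrix.mulVec, dotProduct, Finset.mul_sum, mul_assoc]
  have hTJ : ∀ v, T v = ∫ y, φ y • Matrix.toEuclideanLin (J y) v := by
    intro v
    ext i
    rw [eval_integral_piLp (hJv v)]
    calc (T v) i = ∑ j, v j * T (EuclideanSpace.single j 1) i := by
          conv_lhs => rw [← (EuclideanSpace.basisFun (Fin N) ℝ).sum_repr v]
          simp
      _ = ∑ j, ∫ y, φ y * J y i j * v j := by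
          refine Finset.sum_congr rfl fun j _ => ?_
          rw [hTe, integral_mul_const, mul_comm]
      _ = ∫ y, ∑ j, φ y * J y i j * v j :=
          (integral_finsetSum _ fun j _ => (hJint i j).mul_const _).symm
      _ = ∫ y, (φ y • Matrix.toEuclideanLin (J y) v) i := by
          refine integral_congr_ae (.of_forall fun y => ?_)
          simp [Matrix.mulVec, dotProduct, Finset.mul_sum, mul_assoc]
  refine T.opNorm_le_bound hC fun v => ?_
  rw [hTJ]
  calc ‖∫ y, φ y • Matrix.toEuclideanLin (J y) v‖ ≤ ∫ y, φ y * (C * ‖v‖) := by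
        refine norm_integral_le_of_norm_le (hφi.mul_const _) ?_
        filter_upwards [hJC] with y hy
        rw [norm_smul, Real.norm_of_nonneg (hφ0 y)]
        by_cases hyU : y ∈ U
        · exact mul_le_mul_of_nonneg_left (hy hyU v) (hφ0 y)
        · rw [hφsupp y fun h => hyU (hx h)]
          simp
    _ = C * ‖v‖ := by rw [integral_mul_const, hφ1, one_mul]

/-- A bounded map with weak Jacobian at most `C` on a bounded open set `U` satisfies, off a null
set, the mean value inequality along polygons in `U`. -/
theorem HasWeakJacobian.exists_ae_dist_le {N : ℕ} {U : Set (EuclideanSpace ℝ (Fin N))}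
    (hU : IsOpen U) (hUb : Bornology.IsBounded U)
    {F : EuclideanSpace ℝ (Fin N) → EuclideanSpace ℝ (Fin N)} (hFb : Bornology.IsBounded (F '' U))
    {J : EuclideanSpace ℝ (Fin N) → Matrix (Fin N) (Fin N) ℝ} (hJ : HasWeakJacobian U F J) {C : ℝ}
    (hC : 0 ≤ C) (hJC : ∀ᵐ x, x ∈ U → ∀ v, ‖Matrix.toEuclideanLin (J x) v‖ ≤ C * ‖v‖) :
    ∃ A ⊆ U, (∀ᵐ x, x ∈ U → x ∈ A) ∧ ∀ p ∈ A, ∀ q ∈ A, ∀ L, JoinedByPolygon U L p q →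
      dist (F p) (F q) ≤ C * L * dist p q := by
  have hFm : AEStronglyMeasurable F (volume.restrict U) := by
    rcases isEmpty_or_nonempty (Fin N) with hN | ⟨⟨j⟩⟩
    · exact (measurable_of_subsingleton_codomain F).aestronglyMeasurable
    · have h1 : AEMeasurable F (volume.restrict U) := by
        have h2 : AEMeasurable (fun x => (F x).ofLp) (volume.restrict U) :=
          aemeasurable_pi_lambda _ fun i => (hJ i j).1.aestronglyMeasurable.aemeasurable
        exact (WithLp.measurable_toLp 2 _).comp_aemeasurable h2
      exact h1.aestronglyMeasurable
  have hFi : LocallyIntegrable (U.indicator F) volume := by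
    obtain ⟨M, hM⟩ := hFb.exists_norm_le
    have : IsFiniteMeasure (volume.restrict U) :=
      isFiniteMeasure_restrict.2 hUb.measure_lt_top.ne
    have h1 : IntegrableOn F U volume :=
      Integrable.of_bound hFm M ((ae_restrict_iff' hU.measurableSet).2
        (.of_forall fun x hx => hM _ (mem_image_of_mem F hx)))
    exact (h1.integrable_indicator hU.measurableSet).locallyIntegrable
  let ψ : ℕ → ContDiffBump (0 : EuclideanSpace ℝ (Fin N)) := fun n =>
    ⟨1 / ((n : ℝ) + 1), 2 * (1 / ((n : ℝ) + 1)), by positivity, by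
      have : 0 < 1 / ((n : ℝ) + 1) := by positivity
      linarith⟩
  have hψ : Filter.Tendsto (fun n => (ψ n).rOut) Filter.atTop (nhds 0) := by
    have h := (tendsto_one_div_add_atTop_nhds_zero_nat (𝕜 := ℝ)).const_mul 2
    rwa [mul_zero] at h
  have hlim := ContDiffBump.ae_convolution_tendsto_right_of_locallyIntegrable (μ := volume) (K := 2)
    hψ (.of_forall fun n => le_rfl) hFi
  set f := fun n => (ψ n).normed volume ⋆[ContinuousLinearMap.lsmul ℝ ℝ, volume] U.indicator F
    with hf
  have hseg : ∀ p q, segment ℝ p q ⊆ U → ∀ᶠ n in Filter.atTop,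
      dist (f n p) (f n q) ≤ C * dist p q := by
    intro p q hpq
    have hcpt : IsCompact (segment ℝ p q) := by
      rw [segment_eq_image_lineMap]
      exact isCompact_Icc.image AffineMap.lineMap_continuous
    obtain ⟨δ, hδ, hδU⟩ := hcpt.exists_cthickening_subset_open hU hpq
    filter_upwards [hψ.eventually (gt_mem_nhds hδ)] with n hn
    have hball : ∀ x ∈ segment ℝ p q, Metric.closedBall x (ψ n).rOut ⊆ U := fun x hx =>
      (Metric.closedBall_subset_closedBall hn.le).trans
        ((Metric.closedBall_subset_cthickening hx δ).trans hδU)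
    choose! T hT hTC using fun x hx =>
      hJ.exists_hasFDerivAt_convolution hFi hC hJC (ψ n) (hball x hx)
    rw [dist_comm, dist_comm p, dist_eq_norm, dist_eq_norm]
    exact (convex_segment p q).norm_image_sub_le_of_norm_hasFDerivWithin_le
      (fun x hx => (hT x hx).hasFDerivWithinAt) hTC (left_mem_segment ℝ p q)
      (right_mem_segment ℝ p q)
  refine ⟨{x | x ∈ U ∧ Filter.Tendsto (fun n => f n x) Filter.atTop (nhds (F x))},
    fun x hx => hx.1, ?_, ?_⟩
  · filter_upwards [hlim] with x hx hxU
    rw [indicator_of_mem hxU] at hx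
    exact ⟨hxU, hx⟩
  · rintro p ⟨-, hp⟩ q ⟨-, hq⟩ L ⟨a, b, hpa, hab, hbq, hL⟩
    refine le_of_tendsto (hp.dist hq) ?_
    filter_upwards [hseg p a hpa, hseg a b hab, hseg b q hbq] with n h1 h2 h3
    calc dist (f n p) (f n q)
        ≤ dist (f n p) (f n a) + dist (f n a) (f n b) + dist (f n b) (f n q) :=
          dist_triangle4 _ _ _ _
      _ ≤ C * (dist p a + dist a b + dist b q) := by linarith
      _ ≤ C * (L * dist p q) := by gcongr
      _ = C * L * dist p q := by ring

/-! ### The continuous representative -/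

theorem subset_closure_inter_of_ae {N : ℕ} {U A : Set (EuclideanSpace ℝ (Fin N))} (hU : IsOpen U)
    (hA : ∀ᵐ x, x ∈ U → x ∈ A) : U ⊆ closure (U ∩ A) := by
  refine ((Measure.dense_of_ae hA).open_subset_closure_inter hU).trans (closure_mono ?_)
  exact fun x hx => ⟨hx.1, hx.2 hx.1⟩

/-- A bounded map with bounded weak Jacobian in a bounded Lipschitz domain has a continuous
representative that is Lipschitz at small scales. -/
theorem HasWeakJacobian.exists_continuous_ae_eq {N : ℕ} {Ω : Set (EuclideanSpace ℝ (Fin N))}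
    (hlip : HasLipschitzBoundary Ω) (hb : Bornology.IsBounded Ω) {δ L : ℝ} (hδ : 0 < δ)
    (hjoin : ∀ p ∈ interior Ω, ∀ q ∈ interior Ω, dist p q < δ →
      JoinedByPolygon (interior Ω) L p q)
    {F : EuclideanSpace ℝ (Fin N) → EuclideanSpace ℝ (Fin N)} (hFb : Bornology.IsBounded (F '' Ω))
    {J : EuclideanSpace ℝ (Fin N) → Matrix (Fin N) (Fin N) ℝ}
    (hJ : HasWeakJacobian (interior Ω) F J) {C : ℝ} (hC : 0 ≤ C)
    (hJC : ∀ᵐ x, x ∈ interior Ω → ∀ v, ‖Matrix.toEuclideanLin (J x) v‖ ≤ C * ‖v‖) :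
    ∃ g : EuclideanSpace ℝ (Fin N) → EuclideanSpace ℝ (Fin N), Continuous g ∧
      (∀ᵐ x, x ∈ Ω → g x = F x) ∧
      ∀ p ∈ Ω, ∀ q ∈ Ω, dist p q < δ → dist (g p) (g q) ≤ C * L * dist p q := by
  obtain ⟨A, hAU, hA, hAF⟩ := hJ.exists_ae_dist_le isOpen_interior (hb.subset interior_subset)
    (hFb.subset (image_mono interior_subset)) hC hJC
  obtain ⟨M, hM⟩ := hFb.exists_norm_le
  have hM' : ∀ p ∈ A, ‖F p‖ ≤ M := fun p hp =>
    hM _ (mem_image_of_mem F (interior_subset (hAU hp)))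
  -- Points that are far apart are covered by the bound on `F`.
  have hFA : LipschitzOnWith (max (C * L) (2 * M / δ)).toNNReal F A := by
    refine LipschitzOnWith.of_dist_le_mul fun p hp q hq => ?_
    refine le_trans ?_ (mul_le_mul_of_nonneg_right (Real.le_coe_toNNReal _) dist_nonneg)
    by_cases hpq : dist p q < δ
    · exact (hAF p hp q hq L (hjoin p (hAU hp) q (hAU hq) hpq)).trans
        (mul_le_mul_of_nonneg_right (le_max_left _ _) dist_nonneg)
    · have hM0 : 0 ≤ M := (norm_nonneg _).trans (hM' p hp)
      have h1 : dist (F p) (F q) ≤ 2 * M := by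
        linarith [dist_le_norm_add_norm (F p) (F q), hM' p hp, hM' q hq]
      calc dist (F p) (F q) ≤ 2 * M / δ * δ := by rwa [div_mul_cancel₀ _ hδ.ne']
        _ ≤ max (C * L) (2 * M / δ) * dist p q := by
          exact mul_le_mul (le_max_right _ _) (not_lt.1 hpq) hδ.le
            (le_max_of_le_right (by positivity))
  obtain ⟨g, hg, hgF⟩ := hFA.extend_finite_dimension
  have hΩA : Ω ⊆ closure A :=
    subset_closure.trans (hlip.closure_subset_closure_interior.trans
      (closure_minimal ((subset_closure_inter_of_ae isOpen_interior hA).trans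
        (closure_mono inter_subset_right)) isClosed_closure))
  refine ⟨g, hg.continuous, ?_, fun p hp q hq hpq => ?_⟩
  · filter_upwards [hA, hlip.ae_mem_interior] with x hx hxi hxΩ
    exact (hgF (hx (hxi hxΩ))).symm
  · set W : Set (EuclideanSpace ℝ (Fin N) × EuclideanSpace ℝ (Fin N)) :=
      {z | dist z.1 z.2 < δ}
    have hopen : IsOpen W := isOpen_lt (by fun_prop) (by fun_prop)
    have hpqW : (p, q) ∈ W := hpq
    have hmem : (p, q) ∈ closure (A ×ˢ A) := by
      rw [closure_prod_eq]
      exact mk_mem_prod (hΩA hp) (hΩA hq)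
    have hle : ∀ z ∈ W ∩ A ×ˢ A, dist (g z.1) (g z.2) ≤ C * L * dist z.1 z.2 := by
      rintro z ⟨hz, hz1, hz2⟩
      rw [← hgF hz1, ← hgF hz2]
      exact hAF _ hz1 _ hz2 L (hjoin _ (hAU hz1) _ (hAU hz2) hz)
    have hgc := hg.continuous
    have hcl : (p, q) ∈ closure (W ∩ A ×ˢ A) :=
      hopen.inter_closure (mem_inter hpqW hmem)
    have hc1 : Continuous fun z : EuclideanSpace ℝ (Fin N) × EuclideanSpace ℝ (Fin N) =>
      dist (g z.1) (g z.2) := by fun_prop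
    have hc2 : Continuous fun z : EuclideanSpace ℝ (Fin N) × EuclideanSpace ℝ (Fin N) =>
      C * L * dist z.1 z.2 := by fun_prop
    have h := le_on_closure hle hc1.continuousOn hc2.continuousOn hcl
    simpa only using h

/-- The continuous representatives form a stable scheme. The constants `δ` and `L` come from the
domain alone, so the stability constant is common to all small parameters. -/
theorem IsVariationallyStable.exists_continuous_isStableScheme {S : Type*} [NormedAddCommGroup S]
    {N : ℕ} {Ω : Set (EuclideanSpace ℝ (Fin N))} (hb : Bornology.IsBounded Ω)
    (hlip : HasLipschitzBoundary Ω)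
    {F : S → EuclideanSpace ℝ (Fin N) → EuclideanSpace ℝ (Fin N)}
    (hF : ∀ s, Bornology.IsBounded (F s '' Ω)) (h : IsVariationallyStable Ω F) :
    ∃ G : S → EuclideanSpace ℝ (Fin N) → EuclideanSpace ℝ (Fin N),
      (∀ s, Continuous (G s) ∨ G s = F s) ∧ (∀ s, ∀ᵐ x, x ∈ Ω → G s x = F s x) ∧
        IsStableScheme Ω G := by
  classical
  obtain ⟨s₀, hs₀, C, hC, H⟩ := h
  obtain ⟨δ, hδ, L, hL, hjoin⟩ := hlip.exists_joinedByPolygon hb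
  have key : ∀ s : S, ∃ g : EuclideanSpace ℝ (Fin N) → EuclideanSpace ℝ (Fin N),
      (Continuous g ∨ g = F s) ∧ (∀ᵐ x, x ∈ Ω → g x = F s x) ∧ (‖s‖ ≤ s₀ →
        ∀ p ∈ Ω, ∀ q ∈ Ω, dist p q < δ → dist (g p) (g q) ≤ C * L * dist p q) := by
    intro s
    by_cases hs : ‖s‖ ≤ s₀
    · obtain ⟨J, hJ, hJC⟩ := H s hs
      obtain ⟨g, hg, hgF, hgL⟩ := hJ.exists_continuous_ae_eq hlip hb hδ hjoin (hF s) hC.le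
        (hJC.mono fun x hx hxi v => by simpa using hx hxi 0 v)
      exact ⟨g, .inl hg, hgF, fun _ => hgL⟩
    · exact ⟨F s, .inr rfl, .of_forall fun _ _ => rfl, fun hs' => absurd hs' hs⟩
  choose G hGc hGF hGL using key
  have hCL : 0 < C * L := by positivity
  refine ⟨G, hGc, hGF, s₀, hs₀, C * L, hCL, fun x _ x' _ s hs => ?_⟩
  rw [edist_comm]
  exact edist_le_mul_intrinsicEDist hδ hCL (hGL s hs) x x'

/-- A continuous map on a Lipschitz domain is determined by its values almost everywhere, because
the domain lies in the closure of its interior. -/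
theorem eqOn_of_ae_eq_of_continuousOn {N : ℕ} {Ω : Set (EuclideanSpace ℝ (Fin N))}
    (hlip : HasLipschitzBoundary Ω)
    {f g : EuclideanSpace ℝ (Fin N) → EuclideanSpace ℝ (Fin N)} (hf : ContinuousOn f Ω)
    (hg : ContinuousOn g Ω) (hfg : ∀ᵐ x, x ∈ Ω → f x = g x) : EqOn f g Ω := by
  have hdense : interior Ω ⊆ closure (interior Ω ∩ {x | f x = g x}) :=
    subset_closure_inter_of_ae isOpen_interior
      (hfg.mono fun x hx hxi => hx (interior_subset hxi))
  have heq : EqOn f g (interior Ω ∩ {x | f x = g x}) := fun x hx => hx.2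
  refine heq.of_subset_closure hf hg (inter_subset_left.trans interior_subset) ?_
  exact subset_closure.trans (hlip.closure_subset_closure_interior.trans
    (closure_minimal hdense isClosed_closure))

/-! ### The equivalence -/

theorem theorem3 {S : Type*} [NormedAddCommGroup S] [NormedSpace ℝ S] (N : ℕ)
    (Ω : Set (EuclideanSpace ℝ (Fin N)))
    (hpath : IsInternalPathConnected Ω)
    (hbdd : Bornology.IsBounded Ω)
    (hlip : HasLipschitzBoundary Ω)
    (F : S → EuclideanSpace ℝ (Fin N) → EuclideanSpace ℝ (Fin N))
    (hF : ∀ s, Bornology.IsBounded (F s '' Ω)) :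
    ((∃ G : S → EuclideanSpace ℝ (Fin N) → EuclideanSpace ℝ (Fin N),
        (∀ s, ∀ᵐ x, x ∈ Ω → G s x = F s x) ∧ IsStableScheme Ω G) ↔
      IsVariationallyStable Ω F) ∧
    ((∀ s, ContinuousOn (F s) Ω) →
      (IsStableScheme Ω F ↔ IsVariationallyStable Ω F)) := by
  refine ⟨⟨fun ⟨G, hGF, hG⟩ => hG.isVariationallyStable hGF, fun h => ?_⟩, fun hFc =>
    ⟨fun h => h.isVariationallyStable fun s => .of_forall fun x _ => rfl, fun h => ?_⟩⟩
  · obtain ⟨G, -, hGF, hG⟩ := h.exists_continuous_isStableScheme hbdd hlip hF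
    exact ⟨G, hGF, hG⟩
  · obtain ⟨G, hGc, hGF, s₀, hs₀, C, hC, H⟩ := h.exists_continuous_isStableScheme hbdd hlip hF
    have hGeq : ∀ s, EqOn (G s) (F s) Ω := fun s => by
      rcases hGc s with hc | heq
      · exact eqOn_of_ae_eq_of_continuousOn hlip hc.continuousOn (hFc s) (hGF s)
      · exact fun x _ => congrFun heq x
    refine ⟨s₀, hs₀, C, hC, fun x hx x' hx' s hs => ?_⟩
    rw [← hGeq s hx, ← hGeq s hx']
    exact H x hx x' hx' s hs
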